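/- Let $n\ge 1$ and let $M_{2,n}$ be the Miura-ori with two rows and $n$ columns of congruent parallelograms of acute angle $\theta\in(0,\pi/2)$, placed with obtuse top left corner. A mountain-valley (MV) assignment $\mu$ gives each interior crease a value $+1$ (mountain) or $-1$ (valley); it is locally valid if the four faces around each interior vertex can be folded flat with these creases without self-intersection. Flipping a face reverses the values of the creases bordering it; the face is flippable under a locally valid $\mu$ if the result is again locally valid. The origami flip graph $\mathrm{OFG}(M_{2,n})$ is the simple graph whose vertices are the locally valid MV assignments, two being adjacent if they differ by one face flip. Two locally valid assignments are opposite if they have the same flippable faces and differ in sign on every crease. Let $M^*_{2,n}$ be the dual $2\times n$ grid graph, with vertices $v_{i,j}$. A proper coloring $\gamma$ of $M^*_{2,n}$ by $\mathbb{Z}/3$ corresponds to $\mu$ if, along the path $v_{1,1},\dots,v_{1,n},v_{2,n},\dots,v_{2,1}$, the color increases by $\mu(e)$ modulo $3$ whenever the path crosses the crease $e$ (the color of $v_{1,1}$ is arbitrary). The weight $w(\gamma,P)$ of a directed path $P$ is the sum over its edges $\overrightarrow{uv}$ of the number in $\{1,-1\}$ congruent to $\gamma(v)-\gamma(u)$ modulo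 $3$, and $h_{\gamma,u}(\beta,v)=w(\beta,P)-w(\gamma,P)$ for any directed path $P$ from $u$ to $v$. A recoloring $R$ from $\gamma$ to $\beta$ is a sequence of proper 3-colorings from $\gamma$ to $\beta$, consecutive ones differing at exactly one vertex; its absolute height $H^R_u(\beta)$ starts at $0$ and changes by $+2$ (respectively $-2$) whenever the color of $u$ changes by $-1$ (respectively $+1$) modulo $3$. Then: (1) For any two locally valid MV assignments $\mu_1,\mu_2$ of $M_{2,n}$ there are 3-colorings $\gamma,\beta$ corresponding to $\mu_1,\mu_2$ and a recoloring $R$ from $\gamma$ to $\beta$ such that $H=H^R_{v_{1,1}}(\beta)$ minimizes $\frac12\sum_{v}|H'+h_{\gamma,v_{1,1}}(\beta,v)|$ over all integers $H'$, and $$\frac12\sum_{v\in V(M^*_{2,n})}\bigl|H+h_{\gamma,v_{1,1}}(\beta,v)\bigr|\le\left\lceil\frac{n^2}{2}\right\rceil .$$ (2) $\mathrm{OFG}(M_{2,n})$ is connected, and no two of its vertices are farther apart than two opposite vertices of degree $2$: if $\nu,\nu'$ are opposite vertices of degree $2$, then $d(\mu_1,\mu_2)\le d(\nu,\nu')$ for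 all vertices $\mu_1,\mu_2$. For $n\ge2$ such $\nu,\nu'$ exist. -/

import Mathlib

/-! ## Flat foldings of a degree-4 vertex -/

/-- A flat folding, without self-intersection, of a single vertex with four creases `0, 1, 2, 3` in
cyclic order, sector `i` being the sector of angle `ρ i` between the creases `i` and `i + 1`, in
which crease `i` is a mountain if `m i = 1` and a valley if `m i = -1`.

Folding flat keeps the even sectors face up and turns the odd sectors over, so that the angular
position of the creases increases along even sectors and decreases along odd ones.  (The sector
angles add up to `2π`, so these positions stay within an interval of length at most `π`, and
nothing is lost by measuring them on the line instead of modulo `2π`.)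
The folded sectors are stacked in layers, a larger number meaning a higher layer. -/
structure FlatFolding (ρ : Fin 4 → ℝ) (m : Fin 4 → ℤˣ) where
  /-- angular position of the creases after folding -/
  pos : Fin 4 → ℝ
  /-- height of the sectors in the folded stack -/
  layer : Fin 4 → ℕ
  /-- sectors are folded isometrically (cyclically, so this includes closing up) -/
  pos_next : ∀ i, pos (i + 1) = if Even i.val then pos i + ρ i else pos i - ρ i
  layer_injective : Function.Injective layer
  /-- Crease `i` joins the sectors `i - 1` and `i`, one of which is face up (the even one) and the
  other face down.  It is a mountain (the undersides of the paper touch) exactly if the sector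
  that is face up lies above the other one. -/
  mountain_iff : ∀ i, m i = 1 ↔
    if Even i.val then layer (i - 1) < layer i else layer i < layer (i - 1)
  /-- No sector passes through a crease: a sector with the folded crease `i` in its interior is not
  layered between the two sectors that meet in this crease. -/
  sector_crease : ∀ i k, pos i ∈ Set.uIoo (pos k) (pos (k + 1)) →
    layer k ∉ Set.uIoo (layer (i - 1)) (layer i)
  /-- Two creases folded to the same position, with their sectors on the same side, do not cross:
  their pairs of layers are not interleaved. -/
  crease_crease : ∀ i j, i ≠ j → pos i = pos j → (Even i.val ↔ Even j.val) →
    (layer (j - 1) ∈ Set.uIoo (layer (i - 1)) (layer i) ↔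
      layer j ∈ Set.uIoo (layer (i - 1)) (layer i))

/-! ## The `2 × n` Miura-ori -/

/-- The faces of the `2 × n` Miura-ori: `(0, j)` in the top row, `(1, j)` in the bottom row.
They are also the vertices of the dual grid graph. -/
abbrev MiuraFace (n : ℕ) := Fin 2 × Fin n

/-- The (interior) creases of the `2 × n` Miura-ori. -/
inductive MiuraCrease (n : ℕ) where
  /-- the crease between the faces `(0, j)` and `(1, j)` -/
  | horiz (j : Fin n)
  /-- the crease between the faces `(i, k)` and `(i, k + 1)` -/
  | diag (i : Fin 2) (k : Fin (n - 1))

/-- The creases at the `k`-th interior vertex in cyclic order: left, above, right, below. -/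
def creaseAt {n : ℕ} (k : Fin (n - 1)) : Fin 4 → MiuraCrease n :=
  ![.horiz ⟨k.val, by omega⟩, .diag 0 k, .horiz ⟨k.val + 1, by omega⟩, .diag 1 k]

/-- The sector angles at an interior vertex, beginning with the one between the left and the upper
crease, where `θ` is the acute angle of the parallelograms and the top left corner of the pattern
is obtuse. -/
noncomputable def sectorAngle (θ : ℝ) : Fin 4 → ℝ :=
  ![Real.pi - θ, θ, θ, Real.pi - θ]

/-- The crease `e` borders the face `α`. -/
def Borders {n : ℕ} (e : MiuraCrease n) (α : MiuraFace n) : Prop :=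
  match e with
  | .horiz j => α.2 = j
  | .diag i k => α.1 = i ∧ (α.2.val = k.val ∨ α.2.val = k.val + 1)

/-- Mountain-valley assignments: `1` is a mountain, `-1` a valley. -/
abbrev MVAssignment (n : ℕ) := MiuraCrease n → ℤˣ

/-- The faces around each interior vertex can be folded flat with the prescribed creases. -/
def LocallyValid (n : ℕ) (θ : ℝ) (μ : MVAssignment n) : Prop :=
  ∀ k : Fin (n - 1), Nonempty (FlatFolding (sectorAngle θ) (fun i => μ (creaseAt k i)))

open Classical in
/-- The face flip of `α` under `μ`. -/
noncomputable def faceFlip {n : ℕ} (α : MiuraFace n) (μ : MVAssignment n) : MVAssignment n :=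
  fun e => if Borders e α then -μ e else μ e

/-- The locally valid mountain-valley assignments of the `2 × n` Miura-ori. -/
abbrev ValidMV (n : ℕ) (θ : ℝ) := {μ : MVAssignment n // LocallyValid n θ μ}

/-- The set of flippable faces. -/
def flippableFaces {n : ℕ} {θ : ℝ} (μ : ValidMV n θ) : Set (MiuraFace n) :=
  {α | LocallyValid n θ (faceFlip α μ.val)}

theorem faceFlip_faceFlip {n : ℕ} (α : MiuraFace n) (μ : MVAssignment n) :
    faceFlip α (faceFlip α μ) = μ := by
  funext e
  by_cases h : Borders e α <;> simp [faceFlip, h]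

theorem faceFlip_ne {n : ℕ} (α : MiuraFace n) (μ : MVAssignment n) : μ ≠ faceFlip α μ := by
  intro h
  have h1 := congrFun h (.horiz α.2)
  have h2 : Borders (.horiz α.2) α := rfl
  simp only [faceFlip, h2, if_true] at h1
  exact units_ne_neg_self _ h1

/-- The origami flip graph of the `2 × n` Miura-ori. -/
def OFG (n : ℕ) (θ : ℝ) : SimpleGraph (ValidMV n θ) where
  Adj μ ν := ∃ α : MiuraFace n, ν.val = faceFlip α μ.val
  symm := ⟨by
    rintro μ ν ⟨α, h⟩
    exact ⟨α, by rw [h, faceFlip_faceFlip]⟩⟩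
  loopless := ⟨by
    rintro μ ⟨α, h⟩
    exact faceFlip_ne α μ.val h⟩

/-- The degree of a vertex of the origami flip graph. -/
noncomputable def ofgDegree {n : ℕ} {θ : ℝ} (μ : ValidMV n θ) : ℕ :=
  ((OFG n θ).neighborSet μ).ncard

/-- Opposite assignments: same flippable faces, and opposite parity on every crease. -/
def OppositeMV {n : ℕ} {θ : ℝ} (μ ν : ValidMV n θ) : Prop :=
  flippableFaces μ = flippableFaces ν ∧ ∀ e, ν.val e = -μ.val e

/-! ## 3-colorings of the dual grid graph -/

/-- The dual graph of the `2 × n` Miura-ori, the `2 × n` grid. -/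
abbrev dualGrid (n : ℕ) : SimpleGraph (MiuraFace n) :=
  SimpleGraph.pathGraph 2 □ SimpleGraph.pathGraph n

/-- Proper 3-colorings of the dual grid, with colors in `ℤ/3`. -/
abbrev GridColoring (n : ℕ) := (dualGrid n).Coloring (ZMod 3)

/-- The 3-coloring `γ` corresponds to `μ`, the color of the first vertex being arbitrary: along the
path that runs through the top row from left to right, goes down in the last column and runs
through the bottom row from right to left, the color changes by `μ e` when crossing crease `e`. -/
def Corresponds {n : ℕ} (μ : MVAssignment n) (γ : GridColoring n) : Prop :=
  (∀ k : Fin (n - 1), γ (0, ⟨k.val + 1, by omega⟩) =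
    γ (0, ⟨k.val, by omega⟩) + ((μ (.diag 0 k) : ℤ) : ZMod 3)) ∧
  (∀ j : Fin n, j.val + 1 = n → γ (1, j) = γ (0, j) + ((μ (.horiz j) : ℤ) : ZMod 3)) ∧
  (∀ k : Fin (n - 1), γ (1, ⟨k.val, by omega⟩) =
    γ (1, ⟨k.val + 1, by omega⟩) + ((μ (.diag 1 k) : ℤ) : ZMod 3))

/-- The weight of the directed edge from `u` to `v`: for adjacent `u`, `v`, the number in `{1, -1}`
that is congruent to `γ v - γ u` modulo `3`. -/
def edgeWeight {n : ℕ} (γ : GridColoring n) (u v : MiuraFace n) : ℤ :=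
  (γ v - γ u).valMinAbs

/-- The weight of a directed path. -/
def pathWeight {n : ℕ} (γ : GridColoring n) {u v : MiuraFace n} (P : (dualGrid n).Walk u v) : ℤ :=
  (P.darts.map fun d => edgeWeight γ d.fst d.snd).sum

theorem dualGrid_preconnected (n : ℕ) : (dualGrid n).Preconnected :=
  (SimpleGraph.pathGraph_preconnected 2).boxProd (SimpleGraph.pathGraph_preconnected n)

/-- A directed path from `u` to `v` in the dual grid (weights do not depend on its choice). -/
noncomputable def somePath {n : ℕ} (u v : MiuraFace n) : (dualGrid n).Walk u v :=
  (dualGrid_preconnected n u v).exists_isPath.choose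

/-- The relative height of `β, v` with respect to `γ, u`. -/
noncomputable def relHeight {n : ℕ} (γ : GridColoring n) (u : MiuraFace n) (β : GridColoring n)
    (v : MiuraFace n) : ℤ :=
  pathWeight β (somePath u v) - pathWeight γ (somePath u v)

/-- The 3-coloring reconfiguration graph of the dual grid: two colorings are adjacent if they
differ at exactly one vertex.  A recoloring from `γ` to `β` is a walk from `γ` to `β` in it. -/
def reconfGraph (n : ℕ) : SimpleGraph (GridColoring n) where
  Adj s t := ∃! v, s v ≠ t v
  symm := ⟨by
    intro s t h
    simpa only [ne_comm] using h⟩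
  loopless := ⟨by
    rintro s ⟨v, h, -⟩
    exact h rfl⟩

/-- The change of the absolute height of the vertex `u` when `s` is recolored to `t`. -/
def heightStep {n : ℕ} (u : MiuraFace n) (s t : GridColoring n) : ℤ :=
  if t u = s u then 0 else if t u = s u - 1 then 2 else -2

/-- The absolute height of the vertex `u` at the end of the recoloring `R`. -/
def absHeight {n : ℕ} (u : MiuraFace n) {γ β : GridColoring n} (R : (reconfGraph n).Walk γ β) : ℤ :=
  (R.darts.map fun d => heightStep u d.fst d.snd).sum

/-- The top left vertex of the dual grid. -/
def topLeft (n : ℕ) [NeZero n] : MiuraFace n := (0, 0)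

/-- The sum of `|H + h(v)|` over all vertices `v`, where `h(v)` is the relative height of `β, v`
with respect to `γ` and the top left vertex. -/
noncomputable def heightSum {n : ℕ} [NeZero n] (γ β : GridColoring n) (H : ℤ) : ℤ :=
  ∑ v : MiuraFace n, |H + relHeight γ (topLeft n) β v|

/-! ## Local validity as a linear equation -/

theorem FlatFolding.eq_add {θ : ℝ} (hθ₀ : 0 < θ) (hθ₁ : θ < Real.pi / 2) {m : Fin 4 → ℤˣ}
    (F : FlatFolding (sectorAngle θ) m) : (m 0 : ℤ) = m 1 + m 2 + m 3 := by
  have p0 := F.pos_next 0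
  have p1 := F.pos_next 1
  have p2 := F.pos_next 2
  have e1 : ¬ Even (1 : Fin 4).val := by decide
  have e2 : Even (2 : Fin 4).val := by decide
  have e3 : ¬ Even (3 : Fin 4).val := by decide
  have e0 : Even (0 : Fin 4).val := by decide
  have a1 : (1 + 1 : Fin 4) = 2 := rfl
  have a2 : (2 + 1 : Fin 4) = 3 := rfl
  have a3 : (3 + 1 : Fin 4) = 0 := rfl
  have s0 : (0 - 1 : Fin 4) = 3 := rfl
  have s1 : (1 - 1 : Fin 4) = 0 := rfl
  have s2 : (2 - 1 : Fin 4) = 1 := rfl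
  have s3 : (3 - 1 : Fin 4) = 2 := rfl
  simp only [e0, e1, e2, if_true, if_false, zero_add, a1, a2, sectorAngle, Matrix.cons_val]
    at p0 p1 p2
  have c0 := F.sector_crease 2 0
  have c3 := F.sector_crease 2 3
  have cc := F.crease_crease 1 3 (by decide) (by linarith) (by simp only [e1, e3])
  have cc' := F.crease_crease 3 1 (by decide) (by linarith) (by simp only [e1, e3])
  have m0 := F.mountain_iff 0
  have m1 := F.mountain_iff 1
  have m2 := F.mountain_iff 2
  have m3 := F.mountain_iff 3
  have i01 := F.layer_injective.ne (show (0 : Fin 4) ≠ 1 by decide)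
  have i02 := F.layer_injective.ne (show (0 : Fin 4) ≠ 2 by decide)
  have i03 := F.layer_injective.ne (show (0 : Fin 4) ≠ 3 by decide)
  have i12 := F.layer_injective.ne (show (1 : Fin 4) ≠ 2 by decide)
  have i13 := F.layer_injective.ne (show (1 : Fin 4) ≠ 3 by decide)
  have i23 := F.layer_injective.ne (show (2 : Fin 4) ≠ 3 by decide)
  simp only [e0, e1, e2, e3, if_true, if_false, s0, s1, s2, s3] at m0 m1 m2 m3
  have c0' := c0 (by rw [zero_add]; exact Set.mem_uIoo_of_lt (by linarith) (by linarith))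
  have c3' := c3 (by rw [a3]; exact Set.mem_uIoo_of_gt (by linarith) (by linarith))
  simp only [s1, s2, s3, Set.uIoo, Set.mem_Ioo] at c0' c3' cc cc'
  generalize F.layer 0 = l0 at *
  generalize F.layer 1 = l1 at *
  generalize F.layer 2 = l2 at *
  generalize F.layer 3 = l3 at *
  rcases Int.units_eq_one_or (m 0) with h0 | h0 <;>
  rcases Int.units_eq_one_or (m 1) with h1 | h1 <;>
  rcases Int.units_eq_one_or (m 2) with h2 | h2 <;>
  rcases Int.units_eq_one_or (m 3) with h3 | h3 <;>
  simp only [h0, h1, h2, h3, true_iff, show ((-1 : ℤˣ) = 1) = False by decide, false_iff] at m0 m1 m2 m3 <;>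
  simp only [h0, h1, h2, h3, Units.val_one, Units.val_neg] <;>
  omega

/-- The folded positions of the creases of a Miura vertex. -/
noncomputable def miuraPos (θ : ℝ) : Fin 4 → ℝ :=
  ![0, Real.pi - θ, Real.pi - 2 * θ, Real.pi - θ]

/-- A flat folding of a Miura vertex from an admissible stacking of the four sectors. -/
noncomputable def FlatFolding.ofLayers {θ : ℝ} (hθ₀ : 0 < θ) (hθ₁ : θ < Real.pi / 2)
    {m : Fin 4 → ℤˣ} (l : Fin 4 → ℕ) (hl : Function.Injective l)
    (hm : ∀ i, m i = 1 ↔ if Even i.val then l (i - 1) < l i else l i < l (i - 1))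
    (h0 : l 0 ∉ Set.uIoo (l 1) (l 2)) (h3 : l 3 ∉ Set.uIoo (l 1) (l 2))
    (h13 : l 2 ∈ Set.uIoo (l 0) (l 1) ↔ l 3 ∈ Set.uIoo (l 0) (l 1))
    (h31 : l 0 ∈ Set.uIoo (l 2) (l 3) ↔ l 1 ∈ Set.uIoo (l 2) (l 3)) :
    FlatFolding (sectorAngle θ) m where
  pos := miuraPos θ
  layer := l
  pos_next i := by
    fin_cases i <;> simp [miuraPos, sectorAngle, Nat.even_iff] <;> ring
  layer_injective := hl
  mountain_iff := hm
  sector_crease i k h := by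
    fin_cases i <;> fin_cases k <;>
      simp [miuraPos, Set.uIoo] at h <;> first | exact h0 | exact h3 | (exfalso; grind)
  crease_crease i j hij hp he := by
    fin_cases i <;> fin_cases j <;>
      simp [miuraPos, Nat.even_iff] at hij hp he <;> first | exact h13 | exact h31 | (exfalso; linarith)

theorem FlatFolding.nonempty_of_eq_add {θ : ℝ} (hθ₀ : 0 < θ) (hθ₁ : θ < Real.pi / 2)
    {m : Fin 4 → ℤˣ} (h : (m 0 : ℤ) = m 1 + m 2 + m 3) :
    Nonempty (FlatFolding (sectorAngle θ) m) := by
  have key : ∃ l : Fin 4 → ℕ, Function.Injective l ∧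
      (∀ i, m i = 1 ↔ if Even i.val then l (i - 1) < l i else l i < l (i - 1)) ∧
      l 0 ∉ Set.uIoo (l 1) (l 2) ∧ l 3 ∉ Set.uIoo (l 1) (l 2) ∧
      (l 2 ∈ Set.uIoo (l 0) (l 1) ↔ l 3 ∈ Set.uIoo (l 0) (l 1)) ∧
      (l 0 ∈ Set.uIoo (l 2) (l 3) ↔ l 1 ∈ Set.uIoo (l 2) (l 3)) := by
    simp only [Set.uIoo, Set.mem_Ioo]
    obtain ⟨a, ha⟩ : ∃ a, m 0 = a := ⟨_, rfl⟩
    obtain ⟨b, hb⟩ : ∃ a, m 1 = a := ⟨_, rfl⟩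
    obtain ⟨c, hc⟩ : ∃ a, m 2 = a := ⟨_, rfl⟩
    obtain ⟨d, hd⟩ : ∃ a, m 3 = a := ⟨_, rfl⟩
    simp only [Fin.forall_fin_succ, ha, hb, hc, hd] at h ⊢
    have e : m = ![a, b, c, d] := by
      ext i
      fin_cases i <;> simp [ha, hb, hc, hd]
    subst e
    rcases Int.units_eq_one_or a with rfl | rfl <;>
    rcases Int.units_eq_one_or b with rfl | rfl <;>
    rcases Int.units_eq_one_or c with rfl | rfl <;>
    rcases Int.units_eq_one_or d with rfl | rfl <;>
    first
    | exact absurd h (by decide)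
    | exact ⟨![1, 2, 3, 0], by decide⟩
    | exact ⟨![3, 2, 1, 0], by decide⟩
    | exact ⟨![3, 0, 1, 2], by decide⟩
    | exact ⟨![2, 1, 0, 3], by decide⟩
    | exact ⟨![0, 1, 2, 3], by decide⟩
    | exact ⟨![0, 3, 2, 1], by decide⟩
  obtain ⟨l, hl, hm, h0, h3, h13, h31⟩ := key
  exact ⟨.ofLayers hθ₀ hθ₁ l hl hm h0 h3 h13 h31⟩

theorem locallyValid_iff {n : ℕ} {θ : ℝ} (hθ₀ : 0 < θ) (hθ₁ : θ < Real.pi / 2)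
    {μ : MVAssignment n} : LocallyValid n θ μ ↔ ∀ k : Fin (n - 1),
      (μ (.horiz ⟨k.val, by omega⟩) : ℤ) =
        μ (.diag 0 k) + μ (.horiz ⟨k.val + 1, by omega⟩) + μ (.diag 1 k) :=
  forall_congr' fun _ => ⟨fun ⟨F⟩ => F.eq_add hθ₀ hθ₁,
    fun h => FlatFolding.nonempty_of_eq_add hθ₀ hθ₁ h⟩

/-! ## Height functions -/

namespace MiuraCrease

/-- The face from which a crease is crossed, along the path that runs through the top row, down,
and back through the bottom row. -/
def src {n : ℕ} : MiuraCrease n → MiuraFace n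
  | .horiz j => (0, j)
  | .diag i k => (i, if i = 0 then ⟨k.val, by omega⟩ else ⟨k.val + 1, by omega⟩)

/-- The face reached when a crease is crossed. -/
def dst {n : ℕ} : MiuraCrease n → MiuraFace n
  | .horiz j => (1, j)
  | .diag i k => (i, if i = 0 then ⟨k.val + 1, by omega⟩ else ⟨k.val, by omega⟩)

end MiuraCrease

open MiuraCrease

theorem borders_iff {n : ℕ} (e : MiuraCrease n) (α : MiuraFace n) :
    Borders e α ↔ α = e.src ∨ α = e.dst := by
  obtain ⟨i, j⟩ := α
  cases e with
  | horiz j' => fin_cases i <;> simp [Borders, src, dst]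
  | diag i' k =>
    fin_cases i <;> fin_cases i' <;> simp [Borders, src, dst, Fin.ext_iff]
    omega

theorem dualGrid_adj_iff {n : ℕ} {u v : MiuraFace n} :
    (dualGrid n).Adj u v ↔ (u.1 ≠ v.1 ∧ u.2 = v.2) ∨
      (u.1 = v.1 ∧ (u.2.val + 1 = v.2.val ∨ v.2.val + 1 = u.2.val)) := by
  obtain ⟨i, j⟩ := u
  obtain ⟨i', j'⟩ := v
  fin_cases i <;> fin_cases i' <;>
    simp [SimpleGraph.boxProd_adj, SimpleGraph.pathGraph_adj]

theorem dualGrid_adj_src_dst {n : ℕ} (e : MiuraCrease n) : (dualGrid n).Adj e.src e.dst := by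
  rw [dualGrid_adj_iff]
  cases e with
  | horiz j => simp [src, dst]
  | diag i k => fin_cases i <;> simp [src, dst]

theorem exists_crease_of_adj {n : ℕ} {u v : MiuraFace n} (h : (dualGrid n).Adj u v) :
    ∃ e : MiuraCrease n, (u = e.src ∧ v = e.dst) ∨ (u = e.dst ∧ v = e.src) := by
  rw [dualGrid_adj_iff] at h
  obtain ⟨i, j⟩ := u
  obtain ⟨i', j'⟩ := v
  dsimp only at h
  have hj := j.2
  have hj' := j'.2
  rcases h with ⟨h1, rfl⟩ | ⟨rfl, h | h⟩
  · refine ⟨.horiz j, ?_⟩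
    fin_cases i <;> fin_cases i' <;> simp [src, dst] at h1 ⊢
  · refine ⟨.diag i ⟨j.val, by omega⟩, ?_⟩
    fin_cases i <;> simp [src, dst, Fin.ext_iff, h]
  · refine ⟨.diag i ⟨j'.val, by omega⟩, ?_⟩
    fin_cases i <;> simp [src, dst, Fin.ext_iff, h]

theorem eq_of_forall_crease {n : ℕ} {X : Type*} (F : MiuraFace n → X)
    (h : ∀ e : MiuraCrease n, F e.src = F e.dst) (u v : MiuraFace n) : F u = F v := by
  obtain ⟨p⟩ := dualGrid_preconnected n u v
  induction p with
  | nil => rfl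
  | cons hadj _ ih =>
    obtain ⟨e, ⟨rfl, rfl⟩ | ⟨rfl, rfl⟩⟩ := exists_crease_of_adj hadj
    · exact (h e).trans ih
    · exact (h e).symm.trans ih

/-- Integer functions on the faces that change by `1` or `-1` across every crease. -/
def IsHeight {n : ℕ} (f : MiuraFace n → ℤ) : Prop :=
  ∀ e : MiuraCrease n, |f e.dst - f e.src| = 1

/-- The height function `f` changes by `μ e` across the crease `e`. -/
def Represents {n : ℕ} (f : MiuraFace n → ℤ) (μ : MVAssignment n) : Prop :=
  ∀ e : MiuraCrease n, f e.dst - f e.src = μ e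

theorem Represents.isHeight {n : ℕ} {f : MiuraFace n → ℤ} {μ : MVAssignment n}
    (h : Represents f μ) : IsHeight f := fun e => by
  rw [h e]
  rcases Int.units_eq_one_or (μ e) with h | h <;> simp [h]

theorem IsHeight.exists_represents {n : ℕ} {f : MiuraFace n → ℤ} (h : IsHeight f) :
    ∃ μ : MVAssignment n, Represents f μ := by
  have : ∀ e : MiuraCrease n, ∃ x : ℤˣ, f e.dst - f e.src = x := fun e => by
    rcases (abs_eq zero_le_one).1 (h e) with h | h
    · exact ⟨1, by simpa using h⟩
    · exact ⟨-1, by simpa using h⟩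
  choose μ hμ using this
  exact ⟨μ, hμ⟩

theorem IsHeight.adj {n : ℕ} {f : MiuraFace n → ℤ} (h : IsHeight f) {u v : MiuraFace n}
    (huv : (dualGrid n).Adj u v) : |f v - f u| = 1 := by
  obtain ⟨e, ⟨rfl, rfl⟩ | ⟨rfl, rfl⟩⟩ := exists_crease_of_adj huv
  · exact h e
  · rw [abs_sub_comm]; exact h e

theorem isHeight_of_adj {n : ℕ} {f : MiuraFace n → ℤ}
    (h : ∀ u v, (dualGrid n).Adj u v → |f v - f u| = 1) : IsHeight f :=
  fun e => h _ _ (dualGrid_adj_src_dst e)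

theorem Represents.add_const {n : ℕ} {f : MiuraFace n → ℤ} {μ : MVAssignment n}
    (h : Represents f μ) (c : ℤ) : Represents (fun v => f v + c) μ := fun e => by
  rw [← h e]; ring

theorem Represents.locallyValid {n : ℕ} {θ : ℝ} (hθ₀ : 0 < θ) (hθ₁ : θ < Real.pi / 2)
    {f : MiuraFace n → ℤ} {μ : MVAssignment n} (h : Represents f μ) : LocallyValid n θ μ := by
  rw [locallyValid_iff hθ₀ hθ₁]
  intro k
  rw [← h, ← h, ← h, ← h]
  simp only [src, dst, if_true, one_ne_zero, if_false]
  ring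

theorem exists_represents {n : ℕ} {θ : ℝ} (hθ₀ : 0 < θ) (hθ₁ : θ < Real.pi / 2)
    {μ : MVAssignment n} (h : LocallyValid n θ μ) : ∃ f, Represents f μ := by
  rw [locallyValid_iff hθ₀ hθ₁] at h
  let T : ℕ → ℤ := fun j =>
    ∑ k ∈ Finset.range j, if hk : k < n - 1 then (μ (.diag 0 ⟨k, hk⟩) : ℤ) else 0
  have hT : ∀ k : Fin (n - 1), T (k.val + 1) = T k.val + μ (.diag 0 k) := fun k => by
    simp only [T, Finset.sum_range_succ, k.2, dif_pos]
  refine ⟨fun v => T v.2.val + if v.1 = 0 then 0 else (μ (.horiz v.2) : ℤ), fun e => ?_⟩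
  cases e with
  | horiz j => simp [src, dst]
  | diag i k =>
    have h1 := hT k
    have h2 := h k
    fin_cases i <;> simp [src, dst] <;> omega

/-- Changing the height of one face corresponds to the flip of this face. -/
theorem Represents.update {n : ℕ} {f : MiuraFace n → ℤ} {μ : MVAssignment n}
    (h : Represents f μ) {α : MiuraFace n} {c : ℤ} (hc : c ≠ f α)
    (hf : IsHeight (Function.update f α c)) :
    Represents (Function.update f α c) (faceFlip α μ) := fun e => by
  have h1 := h e
  have h2 := hf e
  have h3 := h.isHeight e
  have hne := (dualGrid_adj_src_dst e).ne
  rw [abs_eq zero_le_one] at h2 h3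
  unfold faceFlip
  by_cases hs : e.src = α
  · subst hs
    rw [if_pos ((borders_iff _ _).2 (Or.inl rfl))]
    simp only [Function.update_self, Function.update_of_ne hne.symm] at h2 ⊢
    push_cast
    omega
  · by_cases hd : e.dst = α
    · subst hd
      rw [if_pos ((borders_iff _ _).2 (Or.inr rfl))]
      simp only [Function.update_self, Function.update_of_ne hne] at h2 ⊢
      push_cast
      omega
    · rw [if_neg (by rw [borders_iff]; tauto)]
      simpa only [Function.update_of_ne hs, Function.update_of_ne hd] using h1

/-- The other face in the same column. -/
def vertNbr {n : ℕ} (α : MiuraFace n) : MiuraFace n := (α.1 + 1, α.2)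

theorem adj_vertNbr {n : ℕ} (α : MiuraFace n) : (dualGrid n).Adj α (vertNbr α) := by
  refine dualGrid_adj_iff.2 (Or.inl ⟨?_, rfl⟩)
  obtain ⟨i, j⟩ := α
  fin_cases i <;> simp [vertNbr]

/-- A valid face flip moves the height of the face to the other side of its neighbors. -/
theorem Represents.exists_of_flip {n : ℕ} {θ : ℝ} (hθ₀ : 0 < θ) (hθ₁ : θ < Real.pi / 2)
    {f : MiuraFace n → ℤ} {μ : MVAssignment n} (h : Represents f μ) {α : MiuraFace n}
    (hα : LocallyValid n θ (faceFlip α μ)) :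
    Represents (Function.update f α (2 * f (vertNbr α) - f α)) (faceFlip α μ) := by
  have h1 := (locallyValid_iff hθ₀ hθ₁).1 (h.locallyValid hθ₀ hθ₁)
  have h2 := (locallyValid_iff hθ₀ hθ₁).1 hα
  obtain ⟨i, j⟩ := α
  intro e
  cases e with
  | horiz j' =>
    have h3 := h (.horiz j')
    simp only [src, dst] at h3 ⊢
    by_cases hj : j' = j
    · subst hj
      fin_cases i <;> simp [faceFlip, Borders, vertNbr] <;> omega
    · have hj' : ¬ j = j' := fun h => hj h.symm
      simpa [faceFlip, Borders, Function.update_apply, hj, hj'] using h3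
  | diag i' k =>
    have h3 := h (.diag 0 k)
    have h4 := h (.diag 1 k)
    have h5 := h (.horiz ⟨k.val, by omega⟩)
    have h6 := h (.horiz ⟨k.val + 1, by omega⟩)
    have h7 := h1 k
    have h8 := h2 k
    obtain ⟨j, hj⟩ := j
    by_cases hjk : j = k.val
    · subst hjk
      fin_cases i <;> fin_cases i' <;>
        simp [src, dst, faceFlip, Borders, vertNbr] at * <;> omega
    · by_cases hjk' : j = k.val + 1
      · subst hjk'
        fin_cases i <;> fin_cases i' <;>
          simp [src, dst, faceFlip, Borders, vertNbr] at * <;> omega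
      · fin_cases i' <;>
          simp [src, dst, faceFlip, Borders, hjk, hjk', Ne.symm hjk,
            Ne.symm hjk'] at * <;> omega

/-! ## Moving one height function to another -/

theorem isHeight_neg {n : ℕ} {f : MiuraFace n → ℤ} (h : IsHeight f) : IsHeight (-f) := fun e => by
  have := h e
  rw [Pi.neg_apply, Pi.neg_apply, ← this, ← abs_neg]
  congr 1
  ring

/-- A face whose neighbors are all one step higher can be raised by `2`, and likewise lowered. -/
theorem IsHeight.update {n : ℕ} {f : MiuraFace n → ℤ} (hf : IsHeight f) {α : MiuraFace n} {δ : ℤ}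
    (hδ : |δ| = 1) (h : ∀ w, (dualGrid n).Adj α w → f w = f α + δ) :
    IsHeight (Function.update f α (f α + 2 * δ)) := by
  refine isHeight_of_adj fun u v huv => ?_
  have hne := huv.ne
  by_cases hu : u = α
  · subst hu
    rw [Function.update_self, Function.update_of_ne hne.symm, h v huv, ← hδ, ← abs_neg]
    congr 1
    ring
  · by_cases hv : v = α
    · subst hv
      rw [Function.update_self, Function.update_of_ne hne, h u huv.symm, ← hδ]
      congr 1
      ring
    · rw [Function.update_of_ne hu, Function.update_of_ne hv, hf.adj huv]

theorem IsHeight.exists_raise {n : ℕ} {f g : MiuraFace n → ℤ} (hf : IsHeight f) (hg : IsHeight g)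
    (hp : ∀ v, Even (g v - f v)) (h : ∃ v, f v < g v) :
    ∃ α, f α + 2 ≤ g α ∧ IsHeight (Function.update f α (f α + 2)) := by
  obtain ⟨v₀, hv₀⟩ := h
  obtain ⟨α, hα, hmin⟩ := (Finset.univ.filter fun v => f v < g v).exists_min_image f
    ⟨v₀, by simpa using hv₀⟩
  simp only [Finset.mem_filter, Finset.mem_univ, true_and] at hα hmin
  have h2 : f α + 2 ≤ g α := by
    have := hp α
    rw [Int.even_iff] at this
    omega
  refine ⟨α, h2, hf.update (δ := 1) (by simp) fun w hw => ?_⟩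
  have h3 := hf.adj hw
  have h4 := hg.adj hw
  have h5 := hmin w
  rw [abs_eq zero_le_one] at h3 h4
  omega

theorem sum_update_dist {V : Type*} [Fintype V] [DecidableEq V] (f g : V → ℤ) (α : V) (c : ℤ) :
    ∑ v, |g v - Function.update f α c v| = ∑ v, |g v - f v| + |g α - c| - |g α - f α| := by
  rw [← Finset.add_sum_erase _ _ (Finset.mem_univ α),
    ← Finset.add_sum_erase Finset.univ (fun v => |g v - f v|) (Finset.mem_univ α)]
  rw [Finset.sum_congr rfl fun v hv => by
    rw [Function.update_of_ne (Finset.ne_of_mem_erase hv)], Function.update_self]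
  ring

theorem IsHeight.exists_step {n : ℕ} {f g : MiuraFace n → ℤ} (hf : IsHeight f) (hg : IsHeight g)
    (hp : ∀ v, Even (g v - f v)) (h : f ≠ g) :
    ∃ α c, (c = f α + 2 ∨ c = f α - 2) ∧ IsHeight (Function.update f α c) ∧
      (∀ v, Even (g v - Function.update f α c v)) ∧
      ∑ v, |g v - Function.update f α c v| + 2 = ∑ v, |g v - f v| := by
  suffices H : ∃ α c, (c = f α + 2 ∨ c = f α - 2) ∧ IsHeight (Function.update f α c) ∧
      |g α - c| + 2 = |g α - f α| by
    obtain ⟨α, c, hc, hu, hs⟩ := H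
    refine ⟨α, c, hc, hu, fun v => ?_, by rw [sum_update_dist]; omega⟩
    by_cases hv : v = α
    · subst hv
      have := hp v
      rw [Function.update_self]
      rw [Int.even_iff] at *
      omega
    · rw [Function.update_of_ne hv]
      exact hp v
  obtain ⟨v, hv⟩ := Function.ne_iff.1 h
  rcases lt_or_gt_of_ne hv with hv | hv
  · obtain ⟨α, h1, h2⟩ := hf.exists_raise hg hp ⟨v, hv⟩
    refine ⟨α, _, Or.inl rfl, h2, ?_⟩
    rw [abs_of_nonneg (by omega), abs_of_nonneg (by omega)]
    ring
  · obtain ⟨α, h1, h2⟩ := (isHeight_neg hf).exists_raise (isHeight_neg hg)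
      (fun w => by
        have := hp w
        rw [Pi.neg_apply, Pi.neg_apply]
        rw [Int.even_iff] at *
        omega) ⟨v, by simpa using hv⟩
    simp only [Pi.neg_apply] at h1
    refine ⟨α, f α - 2, Or.inr rfl, ?_, ?_⟩
    · convert isHeight_neg h2 using 1
      funext w
      by_cases hw : w = α
      · subst hw
        simp only [Function.update_self, Pi.neg_apply]
        ring
      · simp [Function.update_of_ne hw]
    · rw [abs_of_nonpos (by omega), abs_of_nonpos (by omega)]
      ring

theorem Represents.unique {n : ℕ} {f : MiuraFace n → ℤ} {μ ν : MVAssignment n}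
    (h : Represents f μ) (h' : Represents f ν) : μ = ν := by
  funext e
  exact Units.ext ((h e).symm.trans (h' e))

theorem exists_ofg_walk {n : ℕ} {θ : ℝ} (hθ₀ : 0 < θ) (hθ₁ : θ < Real.pi / 2) (N : ℕ) :
    ∀ {f g : MiuraFace n → ℤ} {μ ν : ValidMV n θ}, Represents f μ.val → Represents g ν.val →
      (∀ v, Even (g v - f v)) → ∑ v, |g v - f v| ≤ N →
      ∃ p : (OFG n θ).Walk μ ν, 2 * (p.length : ℤ) = ∑ v, |g v - f v| := by
  induction N using Nat.strong_induction_on with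
  | _ N ih =>
    intro f g μ ν hf hg hp hN
    by_cases hfg : f = g
    · subst hfg
      obtain rfl : μ = ν := Subtype.ext (hf.unique hg)
      exact ⟨.nil, by simp⟩
    · obtain ⟨α, c, hc, hu, hp', hs⟩ := hf.isHeight.exists_step hg.isHeight hp hfg
      have hr := hf.update (by omega) hu
      have h0 : 0 ≤ ∑ v, |g v - Function.update f α c v| :=
        Finset.sum_nonneg fun _ _ => abs_nonneg _
      have hadj : (OFG n θ).Adj μ ⟨_, hr.locallyValid hθ₀ hθ₁⟩ := ⟨α, rfl⟩
      obtain ⟨p, hlen⟩ := ih (N - 2) (by omega) (μ := ⟨_, hr.locallyValid hθ₀ hθ₁⟩) hr hg hp'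
        (by omega)
      refine ⟨.cons hadj p, ?_⟩
      rw [SimpleGraph.Walk.length_cons]
      push_cast
      omega

theorem exists_height_of_ofg_walk {n : ℕ} {θ : ℝ} (hθ₀ : 0 < θ) (hθ₁ : θ < Real.pi / 2)
    {μ ν : ValidMV n θ} (p : (OFG n θ).Walk μ ν) :
    ∀ {f : MiuraFace n → ℤ}, Represents f μ.val → ∃ g, Represents g ν.val ∧
      (∀ v, Even (g v - f v)) ∧ ∑ v, |g v - f v| ≤ 2 * (p.length : ℤ) := by
  induction p with
  | nil => exact fun {f} hf => ⟨f, hf, by simp, by simp⟩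
  | @cons μ μ' ν hflip p ih =>
    intro f hf
    obtain ⟨α, hα⟩ := id hflip
    have hr := hf.exists_of_flip hθ₀ hθ₁ (hα ▸ μ'.2)
    rw [← hα] at hr
    obtain ⟨g, hg, hp, hs⟩ := ih hr
    set c := 2 * f (vertNbr α) - f α with hc
    have hadj : |f (vertNbr α) - f α| = 1 := hf.isHeight.adj (adj_vertNbr α)
    refine ⟨g, hg, fun v => ?_, ?_⟩
    · have := hp v
      by_cases hv : v = α
      · subst hv
        rw [Function.update_self] at this
        rw [Int.even_iff] at *
        omega
      · rwa [Function.update_of_ne hv] at this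
    · rw [sum_update_dist] at hs
      rw [SimpleGraph.Walk.length_cons]
      have h1 : |g α - f α| ≤ |g α - c| + 2 := by
        rw [abs_eq zero_le_one] at hadj
        rcases abs_cases (g α - f α) with h | h <;>
          rcases abs_cases (g α - c) with h' | h' <;> omega
      push_cast
      omega

/-! ## Colorings from height functions -/

/-- The 3-coloring given by a height function modulo `3`. -/
def IsHeight.coloring {n : ℕ} {f : MiuraFace n → ℤ} (hf : IsHeight f) : GridColoring n :=
  SimpleGraph.Coloring.mk (fun v => (f v : ZMod 3)) fun {u v} huv h => by
    have h1 := hf.adj huv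
    rw [← sub_eq_zero, ← Int.cast_sub, ZMod.intCast_zmod_eq_zero_iff_dvd] at h
    rw [abs_eq zero_le_one] at h1
    push_cast at h
    omega

theorem IsHeight.coloring_apply {n : ℕ} {f : MiuraFace n → ℤ} (hf : IsHeight f)
    (v : MiuraFace n) : hf.coloring v = (f v : ZMod 3) := rfl

theorem Represents.corresponds {n : ℕ} {f : MiuraFace n → ℤ} {μ : MVAssignment n}
    (h : Represents f μ) : Corresponds μ h.isHeight.coloring := by
  simp only [Corresponds, IsHeight.coloring_apply, ← h _]
  refine ⟨fun k => ?_, fun j _ => ?_, fun k => ?_⟩ <;> simp [src, dst]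

theorem IsHeight.pathWeight_coloring {n : ℕ} {f : MiuraFace n → ℤ} (hf : IsHeight f)
    {u v : MiuraFace n} (p : (dualGrid n).Walk u v) :
    pathWeight hf.coloring p = f v - f u := by
  induction p with
  | nil => simp [pathWeight]
  | @cons u w v hadj p ih =>
    have h1 : edgeWeight hf.coloring u w = f w - f u := by
      have h2 := hf.adj hadj
      rw [abs_eq zero_le_one] at h2
      rw [edgeWeight, coloring_apply, coloring_apply, ← Int.cast_sub]
      rcases h2 with h | h <;> rw [h] <;> decide
    rw [pathWeight, SimpleGraph.Walk.darts_cons, List.map_cons, List.sum_cons]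
    rw [pathWeight] at ih
    rw [ih, h1]
    ring

theorem IsHeight.relHeight_coloring {n : ℕ} {f g : MiuraFace n → ℤ} (hf : IsHeight f)
    (hg : IsHeight g) (u v : MiuraFace n) :
    relHeight hf.coloring u hg.coloring v = (g v - g u) - (f v - f u) := by
  rw [relHeight, pathWeight_coloring, pathWeight_coloring]

theorem exists_recoloring {n : ℕ} (N : ℕ) (u : MiuraFace n) :
    ∀ {f g : MiuraFace n → ℤ} (hf : IsHeight f) (hg : IsHeight g),
      (∀ v, Even (g v - f v)) → ∑ v, |g v - f v| ≤ N →
      ∃ R : (reconfGraph n).Walk hf.coloring hg.coloring, absHeight u R = g u - f u := by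
  induction N using Nat.strong_induction_on with
  | _ N ih =>
    intro f g hf hg hp hN
    by_cases hfg : f = g
    · subst hfg
      exact ⟨.nil, by simp [absHeight]⟩
    · obtain ⟨α, c, hc, hu, hp', hs⟩ := hf.exists_step hg hp hfg
      have h0 : 0 ≤ ∑ v, |g v - Function.update f α c v| :=
        Finset.sum_nonneg fun _ _ => abs_nonneg _
      obtain ⟨p, hlen⟩ := ih (N - 2) (by omega) hu hg hp' (by omega)
      have hne : (f α : ZMod 3) ≠ c := by
        rcases hc with rfl | rfl <;> push_cast <;> generalize (f α : ZMod 3) = x <;>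
          revert x <;> decide
      have hadj : (reconfGraph n).Adj hf.coloring hu.coloring := by
        refine ⟨α, ?_, fun v hv => ?_⟩
        · simpa only [IsHeight.coloring_apply, Function.update_self] using hne
        · by_contra hvα
          exact hv (by simp only [IsHeight.coloring_apply, Function.update_of_ne hvα])
      refine ⟨.cons hadj p, ?_⟩
      rw [absHeight, SimpleGraph.Walk.darts_cons, List.map_cons, List.sum_cons]
      rw [absHeight] at hlen
      rw [hlen]
      have e1 : hf.coloring u = (f u : ZMod 3) := rfl
      have e2 : hu.coloring u = (Function.update f α c u : ZMod 3) := rfl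
      by_cases huα : u = α
      · subst huα
        rw [Function.update_self] at e2 ⊢
        rw [heightStep, if_neg (by rw [e1, e2]; exact hne.symm)]
        rcases hc with rfl | rfl
        · rw [if_pos (by
            rw [e1, e2]; push_cast; generalize (f u : ZMod 3) = x; revert x; decide)]
          ring
        · rw [if_neg (by
            rw [e1, e2]; push_cast; generalize (f u : ZMod 3) = x; revert x; decide)]
          ring
      · rw [Function.update_of_ne huα] at e2 ⊢
        rw [heightStep, if_pos (e2.trans e1.symm), zero_add]

/-! ## Deviation from the median of a Lipschitz function on the grid -/

theorem exists_eq_of_path {n : ℕ} {x : Fin n → ℤ}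
    (hx : ∀ j j' : Fin n, (SimpleGraph.pathGraph n).Adj j j' → |x j' - x j| ≤ 1) {t : ℤ}
    {a b : Fin n} (ha : x a ≤ t) (hb : t ≤ x b) : ∃ j, x j = t := by
  by_contra! hne
  obtain ⟨p⟩ := SimpleGraph.pathGraph_preconnected n a b
  have key : x b < t := by
    have ha' : x a < t := lt_of_le_of_ne ha (hne a)
    clear ha hb
    induction p with
    | nil => exact ha'
    | cons hadj _ ih =>
      refine ih ?_
      have h1 := abs_le.1 (hx _ _ hadj)
      refine lt_of_le_of_ne ?_ (hne _)
      omega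
  omega

theorem exists_eq_in_row {n : ℕ} {e : MiuraFace n → ℤ}
    (he : ∀ u v, (dualGrid n).Adj u v → |e v - e u| ≤ 1) {t : ℤ} {p q : MiuraFace n}
    (hp : e p < t) (hq : t < e q) (i : Fin 2) : ∃ j, e (i, j) = t := by
  have hcol : ∀ v : MiuraFace n, |e (i, v.2) - e v| ≤ 1 := fun v => by
    by_cases hi : v.1 = i
    · subst hi
      simp
    · exact he _ _ (dualGrid_adj_iff.2 (Or.inl ⟨hi, rfl⟩))
  have h1 := abs_le.1 (hcol p)
  have h2 := abs_le.1 (hcol q)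
  refine exists_eq_of_path (x := fun j => e (i, j)) (fun j j' h => he _ _ ?_) (a := p.2) (b := q.2)
    (by omega) (by omega)
  rw [SimpleGraph.pathGraph_adj] at h
  exact dualGrid_adj_iff.2 (Or.inr ⟨rfl, h⟩)

theorem sum_pos_part_le {n : ℕ} {e : MiuraFace n → ℤ}
    (he : ∀ u v, (dualGrid n).Adj u v → |e v - e u| ≤ 1) (h0 : ∃ p, e p ≤ 0) :
    4 * ∑ v with 0 < e v, e v ≤ (((Finset.univ.filter fun v => 0 < e v).card : ℤ) + 1) ^ 2 := by
  obtain ⟨p, hp⟩ := h0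
  obtain ⟨q, -, hq⟩ := Finset.univ.exists_max_image e ⟨p, Finset.mem_univ p⟩
  set S := Finset.univ.filter fun v => 0 < e v with hS
  by_cases hM : e q ≤ 0
  · have : S = ∅ := by
      refine Finset.filter_false_of_mem fun v _ => ?_
      have := hq v (Finset.mem_univ v)
      omega
    simp [this]
  obtain ⟨m, hm⟩ := Int.eq_ofNat_of_zero_le (show 0 ≤ e q - 1 by omega)
  have hlev : ∀ (i : Fin 2) (k : ℕ), ∃ j, k < m → e (i, j) = m - k := fun i k => by
    by_cases hk : k < m
    · obtain ⟨j, hj⟩ := exists_eq_in_row he (t := m - k) (p := p) (q := q) (by omega) (by omega) i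
      exact ⟨j, fun _ => hj⟩
    · exact ⟨p.2, fun h => absurd h hk⟩
  choose c hc using hlev
  let φ : Fin 2 × ℕ → MiuraFace n := fun x => (x.1, c x.1 x.2)
  have hφ : Set.InjOn φ (Finset.univ ×ˢ Finset.range m : Finset (Fin 2 × ℕ)) := by
    rintro ⟨i, k⟩ h ⟨i', k'⟩ h' heq
    simp only [Finset.coe_product, Set.mem_prod, Finset.mem_coe, Finset.mem_range] at h h'
    have h1 := hc i k h.2
    have h2 := hc i' k' h'.2
    simp only [φ, Prod.mk.injEq] at heq
    obtain ⟨rfl, h3⟩ := heq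
    rw [h3] at h1
    simp only [Prod.mk.injEq, true_and]
    omega
  have hsum : ∀ r : ℕ, 2 * ∑ k ∈ Finset.range r, ((k : ℤ) + 1) = r * (r + 1) := fun r => by
    induction r with
    | zero => simp
    | succ r ih =>
      rw [Finset.sum_range_succ, mul_add, ih]
      push_cast
      ring
  have hle : (m : ℤ) * (m + 1) ≤ ∑ v ∈ S, (e q - e v) := by
    calc (m : ℤ) * (m + 1)
        = ∑ x ∈ (Finset.univ ×ˢ Finset.range m : Finset (Fin 2 × ℕ)), ((x.2 : ℤ) + 1) := by
          rw [Finset.sum_product, ← hsum]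
          simp
      _ = ∑ x ∈ (Finset.univ ×ˢ Finset.range m : Finset (Fin 2 × ℕ)), (e q - e (φ x)) := by
          refine Finset.sum_congr rfl fun x hx => ?_
          have := hc x.1 x.2 (by simpa using hx)
          simp only [φ]
          omega
      _ = ∑ v ∈ (Finset.univ ×ˢ Finset.range m : Finset (Fin 2 × ℕ)).image φ, (e q - e v) :=
          (Finset.sum_image (f := fun v => e q - e v) hφ).symm
      _ ≤ ∑ v ∈ S, (e q - e v) := by
          refine Finset.sum_le_sum_of_subset_of_nonneg (fun v hv => ?_) fun v _ _ => ?_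
          · obtain ⟨x, hx, rfl⟩ := Finset.mem_image.1 hv
            have hx' : x.2 < m := by simpa using hx
            have := hc x.1 x.2 hx'
            simp only [hS, Finset.mem_filter, Finset.mem_univ, true_and, φ]
            omega
          · have := hq v (Finset.mem_univ v)
            omega
  rw [Finset.sum_sub_distrib, Finset.sum_const, nsmul_eq_mul] at hle
  have hq' : e q = m + 1 := by omega
  rw [hq'] at hle
  nlinarith [sq_nonneg ((S.card : ℤ) + 1 - 2 * (m + 1))]

theorem two_mul_sum_abs_le {n : ℕ} {e : MiuraFace n → ℤ} (hn : 0 < n)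
    (he : ∀ u v, (dualGrid n).Adj u v → |e v - e u| ≤ 1)
    (hpos : (Finset.univ.filter fun v => 0 < e v).card ≤ n)
    (hneg : (Finset.univ.filter fun v => e v < 0).card ≤ n) :
    2 * ∑ v, |e v| ≤ (n : ℤ) ^ 2 + 1 := by
  have hcard : Fintype.card (MiuraFace n) = 2 * n := by simp
  have hsplit : ∑ v, |e v| = ∑ v with 0 < e v, e v + ∑ v with e v < 0, -e v := by
    rw [Finset.sum_filter, Finset.sum_filter, ← Finset.sum_add_distrib]
    refine Finset.sum_congr rfl fun v _ => ?_
    rcases lt_trichotomy (e v) 0 with h | h | h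
    · rw [abs_of_neg h, if_neg h.not_gt, if_pos h, zero_add]
    · simp [h]
    · rw [abs_of_pos h, if_neg h.not_gt, if_pos h, add_zero]
  have hex : ∀ P : MiuraFace n → Prop, ∀ [DecidablePred P],
      (Finset.univ.filter P).card ≤ n → ∃ v, ¬ P v := fun P _ h => by
    by_contra! hall
    rw [Finset.filter_true_of_mem fun v _ => hall v, Finset.card_univ, hcard] at h
    omega
  have hP := sum_pos_part_le he (by simpa using hex _ hpos)
  have hN := sum_pos_part_le (e := fun v => -e v)
    (fun u v h => by
      rw [← abs_neg]
      convert he u v h using 2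
      ring) (by simpa using hex _ hneg)
  simp only [Left.neg_pos_iff] at hN
  set A := Finset.univ.filter fun v => 0 < e v with hA
  set B := Finset.univ.filter fun v => e v < 0 with hB
  rw [hsplit]
  zify at hpos hneg
  have hn' : (1 : ℤ) ≤ n := by exact_mod_cast hn
  have hA0 : (0 : ℤ) ≤ A.card := by positivity
  have hB0 : (0 : ℤ) ≤ B.card := by positivity
  rcases A.eq_empty_or_nonempty with h | ⟨q, hq⟩
  · rw [h, Finset.sum_empty]
    nlinarith [sq_nonneg ((n : ℤ) - 1)]
  rcases B.eq_empty_or_nonempty with h | ⟨p, hp⟩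
  · rw [h, Finset.sum_empty]
    nlinarith [sq_nonneg ((n : ℤ) - 1)]
  have hp' : e p < 0 := by simpa [hB] using hp
  have hq' : 0 < e q := by simpa [hA] using hq
  obtain ⟨j₀, h₀⟩ := exists_eq_in_row he hp' hq' 0
  obtain ⟨j₁, h₁⟩ := exists_eq_in_row he hp' hq' 1
  have hAB : A.card + B.card + 2 ≤ 2 * n := by
    have hd : Disjoint A B := by
      refine Finset.disjoint_filter.2 fun v _ h1 h2 => ?_
      omega
    have hd' : Disjoint (A ∪ B) {(0, j₀), (1, j₁)} := by
      rw [Finset.disjoint_left]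
      intro v hv hv'
      simp only [hA, hB, Finset.mem_union, Finset.mem_filter, Finset.mem_univ, true_and] at hv
      simp only [Finset.mem_insert, Finset.mem_singleton] at hv'
      rcases hv' with rfl | rfl <;> omega
    have h2 : ({(0, j₀), (1, j₁)} : Finset (MiuraFace n)).card = 2 :=
      Finset.card_pair (by simp)
    have h3 := Finset.card_le_univ ((A ∪ B) ∪ {(0, j₀), (1, j₁)})
    rwa [Finset.card_union_of_disjoint hd', Finset.card_union_of_disjoint hd, h2, hcard] at h3
  zify at hAB
  have hsq : ((A.card : ℤ) + 1) ^ 2 + ((B.card : ℤ) + 1) ^ 2 ≤ 2 * (n : ℤ) ^ 2 + 2 := by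
    rcases lt_or_eq_of_le hpos with hlt | heq
    · rcases lt_or_eq_of_le hneg with hlt' | heq'
      · nlinarith
      · nlinarith
    · nlinarith
  omega

theorem exists_median {V : Type*} [Fintype V] (e : V → ℤ) {n : ℕ} (hn : 0 < n)
    (hV : Fintype.card V = 2 * n) :
    ∃ m : ℤ, (Finset.univ.filter fun v => m < e v).card ≤ n ∧
      (Finset.univ.filter fun v => e v < m).card ≤ n := by
  have hne : (Finset.univ : Finset V).Nonempty := by
    rw [← Finset.card_pos, Finset.card_univ]
    omega
  obtain ⟨q, -, hq⟩ := Finset.univ.exists_max_image e hne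
  obtain ⟨p, -, hp⟩ := Finset.univ.exists_min_image e hne
  obtain ⟨m, hm, hmin⟩ := Int.exists_least_of_bdd
    (P := fun z => (Finset.univ.filter fun v => z < e v).card ≤ n)
    ⟨e p, fun z hz => by
      by_contra! hlt
      rw [Finset.filter_true_of_mem fun v hv => hlt.trans_le (hp v hv), Finset.card_univ] at hz
      omega⟩
    ⟨e q, by
      rw [Finset.filter_false_of_mem fun v hv => (hq v hv).not_gt]
      simp⟩
  refine ⟨m, hm, ?_⟩
  have h1 : n < (Finset.univ.filter fun v => m - 1 < e v).card := by
    by_contra! h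
    have := hmin _ h
    omega
  have h2 := Finset.card_filter_add_card_filter_not (s := Finset.univ) (fun v => m - 1 < e v)
  have h3 : (Finset.univ.filter fun v => ¬ (m - 1 < e v)) =
      Finset.univ.filter fun v => e v < m := Finset.filter_congr fun v _ => by omega
  rw [h3, Finset.card_univ] at h2
  omega

theorem sum_abs_le_sum_abs_add {V : Type*} [Fintype V] (e : V → ℤ) {n : ℕ}
    (hV : Fintype.card V = 2 * n) (hpos : (Finset.univ.filter fun v => 0 < e v).card ≤ n)
    (hneg : (Finset.univ.filter fun v => e v < 0).card ≤ n) (K : ℤ) :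
    ∑ v, |e v| ≤ ∑ v, |K + e v| := by
  have hsum : ∀ P : V → Prop, ∀ [DecidablePred P], ∀ L : ℤ,
      ∑ v, (L - 2 * L * if P v then 1 else 0) =
        2 * L * (n - ((Finset.univ.filter P).card : ℤ)) := fun P _ L => by
    rw [Finset.sum_sub_distrib, ← Finset.mul_sum, Finset.sum_boole, Finset.sum_const,
      Finset.card_univ, hV, nsmul_eq_mul]
    push_cast
    ring
  rw [← sub_nonneg, ← Finset.sum_sub_distrib]
  zify at hpos hneg
  rcases le_total 0 K with hK | hK
  · refine le_trans ?_ (Finset.sum_le_sum (f := fun v => K - 2 * K * if e v < 0 then 1 else 0)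
      fun v _ => ?_)
    · rw [hsum]
      exact mul_nonneg (by omega) (by omega)
    · split_ifs with h
      · rcases abs_cases (K + e v) with h1 | h1 <;> rcases abs_cases (e v) with h2 | h2 <;> omega
      · rcases abs_cases (K + e v) with h1 | h1 <;> rcases abs_cases (e v) with h2 | h2 <;> omega
  · refine le_trans ?_ (Finset.sum_le_sum
      (f := fun v => -K - 2 * (-K) * if 0 < e v then 1 else 0) fun v _ => ?_)
    · rw [hsum]
      exact mul_nonneg (by omega) (by omega)
    · split_ifs with h
      · rcases abs_cases (K + e v) with h1 | h1 <;> rcases abs_cases (e v) with h2 | h2 <;> omega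
      · rcases abs_cases (K + e v) with h1 | h1 <;> rcases abs_cases (e v) with h2 | h2 <;> omega

/-- Height functions representing two assignments can be chosen so that their difference is even,
with median `0`. -/
theorem exists_representing_pair {n : ℕ} [NeZero n] {θ : ℝ} (hθ₀ : 0 < θ) (hθ₁ : θ < Real.pi / 2)
    (μ₁ μ₂ : ValidMV n θ) : ∃ f g : MiuraFace n → ℤ, Represents f μ₁.val ∧ Represents g μ₂.val ∧
      (∀ v, Even (g v - f v)) ∧ ∑ v, |g v - f v| ≤ (n : ℤ) ^ 2 + 1 ∧
      ∀ K : ℤ, ∑ v, |g v - f v| ≤ ∑ v, |K + (g v - f v)| := by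
  have hn : 0 < n := Nat.pos_of_neZero n
  have hcard : Fintype.card (MiuraFace n) = 2 * n := by simp
  obtain ⟨f, hf⟩ := exists_represents hθ₀ hθ₁ μ₁.2
  obtain ⟨g, hg⟩ := exists_represents hθ₀ hθ₁ μ₂.2
  have hmod : ∀ u v, (g u - f u) % 2 = (g v - f v) % 2 :=
    eq_of_forall_crease (fun v => (g v - f v) % 2) fun e => by
      have h1 := hf.isHeight e
      have h2 := hg.isHeight e
      rw [abs_eq zero_le_one] at h1 h2
      omega
  let r := (g (topLeft n) - f (topLeft n)) % 2
  let e : MiuraFace n → ℤ := fun v => (g v - f v) / 2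
  have he : ∀ v, g v - f v = 2 * e v + r := fun v => by
    have := hmod v (topLeft n)
    simp only [e, r]
    omega
  obtain ⟨m, hm1, hm2⟩ := exists_median e hn hcard
  have hdiff : ∀ v, g v + (-r - 2 * m) - f v = 2 * (e v - m) := fun v => by
    have := he v
    omega
  refine ⟨f, _, hf, hg.add_const (-r - 2 * m), fun v => ?_, ?_, fun K => ?_⟩
  · rw [hdiff]
    exact even_two_mul _
  · simp only [hdiff, abs_mul, abs_two, ← Finset.mul_sum]
    refine two_mul_sum_abs_le (e := fun v => e v - m) hn (fun u v huv => ?_)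
      (by simpa only [sub_pos] using hm1) (by simpa only [sub_neg] using hm2)
    have h1 := hf.isHeight.adj huv
    have h2 := hg.isHeight.adj huv
    have h3 := he u
    have h4 := he v
    rw [abs_eq zero_le_one] at h1 h2
    rw [abs_le]
    omega
  · simp only [hdiff]
    refine sum_abs_le_sum_abs_add (fun v => 2 * (e v - m)) hcard ?_ ?_ K
    · rwa [Finset.filter_congr (q := fun v => m < e v) fun v _ => by omega]
    · rwa [Finset.filter_congr (q := fun v => e v < m) fun v _ => by omega]

/-! ## Flippable faces and degrees -/

theorem mem_flippableFaces_iff {n : ℕ} {θ : ℝ} (hθ₀ : 0 < θ) (hθ₁ : θ < Real.pi / 2)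
    {f : MiuraFace n → ℤ} {μ : ValidMV n θ} (hf : Represents f μ.val) (α : MiuraFace n) :
    α ∈ flippableFaces μ ↔ ∀ w, (dualGrid n).Adj α w → f w = f (vertNbr α) := by
  have h0 := hf.isHeight.adj (adj_vertNbr α)
  constructor
  · intro h w hw
    have h1 := (hf.exists_of_flip hθ₀ hθ₁ h).isHeight.adj hw
    have h2 := hf.isHeight.adj hw
    rw [Function.update_self, Function.update_of_ne hw.ne.symm] at h1
    rw [abs_eq zero_le_one] at h0 h1 h2
    omega
  · intro h
    refine (hf.update ?_ (hf.isHeight.update h0 fun w hw => ?_)).locallyValid hθ₀ hθ₁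
    · rw [abs_eq zero_le_one] at h0
      omega
    · rw [h w hw]
      ring

theorem faceFlip_injective {n : ℕ} (hn : 2 ≤ n) (μ : MVAssignment n) {α β : MiuraFace n}
    (h : faceFlip α μ = faceFlip β μ) : α = β := by
  have key : ∀ e, Borders e α → Borders e β := fun e he => by
    by_contra hb
    have h1 := congrFun h e
    rw [faceFlip, faceFlip, if_pos he, if_neg hb] at h1
    exact units_ne_neg_self _ h1.symm
  have h2 : β.2 = α.2 := key (.horiz α.2) rfl
  obtain ⟨k, hk⟩ : ∃ k : Fin (n - 1), α.2.val = k.val ∨ α.2.val = k.val + 1 := by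
    have := α.2.2
    by_cases h0 : α.2.val = 0
    · exact ⟨⟨0, by omega⟩, Or.inl h0⟩
    · exact ⟨⟨α.2.val - 1, by omega⟩, Or.inr (by dsimp only; omega)⟩
  have h1 : β.1 = α.1 := (key (.diag α.1 k) ⟨rfl, hk⟩).1
  exact Prod.ext h1.symm h2.symm

theorem ofgDegree_eq {n : ℕ} {θ : ℝ} (hn : 2 ≤ n) (μ : ValidMV n θ) :
    ofgDegree μ = (flippableFaces μ).ncard := by
  refine (Set.ncard_congr (s := flippableFaces μ)
    (t := (OFG n θ).neighborSet μ) (fun α hα => (⟨faceFlip α μ.val, hα⟩ : ValidMV n θ))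
    (fun α _ => ⟨α, rfl⟩) (fun _ _ _ _ h => faceFlip_injective hn μ.val (congrArg Subtype.val h))
    fun ν hν => ?_).symm
  obtain ⟨α, hα⟩ := hν
  refine ⟨α, ?_, Subtype.ext hα.symm⟩
  show LocallyValid n θ _
  rw [← hα]
  exact ν.2

theorem two_le_of_ofgDegree_eq_two {n : ℕ} {θ : ℝ} {μ : ValidMV n θ} (h : ofgDegree μ = 2) :
    2 ≤ n := by
  by_contra! hn
  have hfin : ((OFG n θ).neighborSet μ).Finite :=
    Set.finite_of_ncard_ne_zero (by rw [← ofgDegree, h]; decide)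
  have hflip : ∀ α : MiuraFace n, faceFlip α μ.val = -μ.val := fun α => by
    funext e
    cases e with
    | horiz j => exact if_pos (Fin.ext (by omega))
    | diag i k => exact absurd k.2 (by omega)
  have hle : ofgDegree μ ≤ 1 := by
    refine (Set.ncard_le_one hfin).2 fun ν hν ν' hν' => Subtype.ext ?_
    obtain ⟨α, hα⟩ := hν
    obtain ⟨α', hα'⟩ := hν'
    rw [hα, hα', hflip, hflip]
  omega

/-! ## Assignments with two flippable faces -/

/-- The distance of two faces in the grid. -/
def gridDist {n : ℕ} (u v : MiuraFace n) : ℤ :=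
  |(u.1.val : ℤ) - v.1.val| + |(u.2.val : ℤ) - v.2.val|

theorem gridDist_le_of_adj {n : ℕ} {v w : MiuraFace n} (h : (dualGrid n).Adj v w)
    (u : MiuraFace n) : gridDist u v ≤ gridDist u w + 1 := by
  have h1 : |(w.1.val : ℤ) - v.1.val| + |(w.2.val : ℤ) - v.2.val| ≤ 1 := by
    have := v.1.2
    have := w.1.2
    rcases dualGrid_adj_iff.1 h with ⟨-, h2⟩ | ⟨h2, h3 | h3⟩
    · rw [h2, sub_self, abs_zero, add_zero, abs_le]
      omega
    · rw [h2, sub_self, abs_zero, zero_add, abs_le]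
      omega
    · rw [h2, sub_self, abs_zero, zero_add, abs_le]
      omega
  have h2 := abs_sub_le (u.1.val : ℤ) w.1.val v.1.val
  have h3 := abs_sub_le (u.2.val : ℤ) w.2.val v.2.val
  unfold gridDist
  omega

theorem exists_adj_gridDist {n : ℕ} {u v : MiuraFace n} (h : u ≠ v) :
    ∃ w, (dualGrid n).Adj u w ∧ gridDist w v + 1 = gridDist u v := by
  by_cases h1 : u.1 = v.1
  · have h2 : u.2.val ≠ v.2.val := fun h2 => h (Prod.ext h1 (Fin.ext h2))
    have := u.2.2
    have := v.2.2
    rcases lt_or_gt_of_ne h2 with h2 | h2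
    · refine ⟨(u.1, ⟨u.2.val + 1, by omega⟩), dualGrid_adj_iff.2 (Or.inr ⟨rfl, Or.inl rfl⟩), ?_⟩
      simp only [gridDist]
      rw [abs_of_nonpos (a := ((u.2.val + 1 : ℕ) : ℤ) - _) (by omega),
        abs_of_nonpos (a := (u.2.val : ℤ) - _) (by omega)]
      push_cast
      ring
    · refine ⟨(u.1, ⟨u.2.val - 1, by omega⟩),
        dualGrid_adj_iff.2 (Or.inr ⟨rfl, Or.inr (by dsimp only; omega)⟩), ?_⟩
      simp only [gridDist]
      rw [abs_of_nonneg (a := ((u.2.val - 1 : ℕ) : ℤ) - _) (by omega),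
        abs_of_nonneg (a := (u.2.val : ℤ) - _) (by omega)]
      omega
  · refine ⟨(v.1, u.2), dualGrid_adj_iff.2 (Or.inl ⟨h1, rfl⟩), ?_⟩
    have h2 : |(u.1.val : ℤ) - v.1.val| = 1 := by
      have := u.1.2
      have := v.1.2
      have := fun h2 => h1 (Fin.ext h2)
      rw [abs_eq zero_le_one]
      omega
    simp only [gridDist, h2, sub_self, abs_zero]
    ring

theorem IsHeight.sub_le_gridDist {n : ℕ} {f : MiuraFace n → ℤ} (hf : IsHeight f) (k : ℕ) :
    ∀ {u v : MiuraFace n}, gridDist u v ≤ k → f v - f u ≤ gridDist u v := by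
  induction k with
  | zero =>
    intro u v h
    by_cases huv : u = v
    · subst huv
      simp [gridDist]
    · obtain ⟨w, -, hw⟩ := exists_adj_gridDist huv
      have : 0 ≤ gridDist w v := by unfold gridDist; positivity
      push_cast at h
      omega
  | succ k ih =>
    intro u v h
    by_cases huv : u = v
    · subst huv
      simp [gridDist]
    · obtain ⟨w, hadj, hw⟩ := exists_adj_gridDist huv
      push_cast at h
      have h1 := ih (u := w) (v := v) (by omega)
      have h2 := (abs_le.1 (hf.adj hadj).le).2
      omega

theorem gridDist_le_of_descent {n : ℕ} {f : MiuraFace n → ℤ} {p : MiuraFace n}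
    (hp : ∀ v, f p ≤ f v) (h : ∀ v, v ≠ p → ∃ w, (dualGrid n).Adj v w ∧ f w = f v - 1) (k : ℕ) :
    ∀ {v : MiuraFace n}, f v - f p ≤ k → gridDist p v ≤ f v - f p := by
  induction k with
  | zero =>
    intro v hv
    by_cases hvp : v = p
    · subst hvp
      simp [gridDist]
    · obtain ⟨w, -, hw⟩ := h v hvp
      have := hp w
      push_cast at hv
      omega
  | succ k ih =>
    intro v hv
    by_cases hvp : v = p
    · subst hvp
      simp [gridDist]
    · obtain ⟨w, hadj, hw⟩ := h v hvp
      push_cast at hv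
      have h1 := ih (v := w) (by omega)
      have h2 := gridDist_le_of_adj hadj p
      omega

/-- An assignment with only two flippable faces has the distance from a corner as height. -/
theorem exists_eq_gridDist_of_degree_two {n : ℕ} {θ : ℝ} (hθ₀ : 0 < θ) (hθ₁ : θ < Real.pi / 2)
    {f : MiuraFace n → ℤ} {μ : ValidMV n θ} (hf : Represents f μ.val) (h : ofgDegree μ = 2) :
    ∃ p : MiuraFace n, (p.2.val = 0 ∨ p.2.val + 1 = n) ∧ ∀ v, f v = f p + gridDist p v := by
  have hn := two_le_of_ofgDegree_eq_two h
  rw [ofgDegree_eq hn] at h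
  have hne : (Finset.univ : Finset (MiuraFace n)).Nonempty := ⟨(0, ⟨0, by omega⟩), Finset.mem_univ _⟩
  obtain ⟨p, -, hp⟩ := Finset.univ.exists_min_image f hne
  obtain ⟨q, -, hq⟩ := Finset.univ.exists_max_image f hne
  replace hp := fun v => hp v (Finset.mem_univ v)
  replace hq := fun v => hq v (Finset.mem_univ v)
  have hadj : ∀ {u v : MiuraFace n}, (dualGrid n).Adj u v → f v = f u + 1 ∨ f v = f u - 1 :=
    fun huv => by
      have := hf.isHeight.adj huv
      rw [abs_eq zero_le_one] at this
      omega
  have hpf : p ∈ flippableFaces μ := by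
    rw [mem_flippableFaces_iff hθ₀ hθ₁ hf]
    intro w hw
    have h1 := hadj hw
    have h2 := hadj (adj_vertNbr p)
    have h3 := hp w
    have h4 := hp (vertNbr p)
    omega
  have hqf : q ∈ flippableFaces μ := by
    rw [mem_flippableFaces_iff hθ₀ hθ₁ hf]
    intro w hw
    have h1 := hadj hw
    have h2 := hadj (adj_vertNbr q)
    have h3 := hq w
    have h4 := hq (vertNbr q)
    omega
  have hpq : p ≠ q := by
    rintro rfl
    have h2 := hadj (adj_vertNbr p)
    have h3 := hp (vertNbr p)
    have h4 := hq (vertNbr p)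
    omega
  have hset : ({p, q} : Set (MiuraFace n)) = flippableFaces μ := by
    refine Set.eq_of_subset_of_ncard_le ?_ ?_ (Set.toFinite _)
    · rintro v (rfl | rfl)
      · exact hpf
      · exact hqf
    · rw [h, Set.ncard_pair hpq]
  have hmid : ∀ v, v ≠ p → v ≠ q → ∃ w w', (dualGrid n).Adj v w ∧ (dualGrid n).Adj v w' ∧
      f w = f v - 1 ∧ f w' = f v + 1 := fun v hvp hvq => by
    have hv : v ∉ flippableFaces μ := by
      rw [← hset]
      simp [hvp, hvq]
    rw [mem_flippableFaces_iff hθ₀ hθ₁ hf] at hv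
    push Not at hv
    obtain ⟨w, hw, hne⟩ := hv
    rcases hadj hw with h1 | h1 <;> rcases hadj (adj_vertNbr v) with h2 | h2
    · omega
    · exact ⟨_, _, adj_vertNbr v, hw, h2, h1⟩
    · exact ⟨_, _, hw, adj_vertNbr v, h1, h2⟩
    · omega
  have hdown : ∀ v, v ≠ p → ∃ w, (dualGrid n).Adj v w ∧ f w = f v - 1 := fun v hv => by
    by_cases hvq : v = q
    · subst hvq
      refine ⟨_, adj_vertNbr v, ?_⟩
      have h1 := hadj (adj_vertNbr v)
      have h2 := hq (vertNbr v)
      omega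
    · obtain ⟨w, -, hw, -, h1, -⟩ := hmid v hv hvq
      exact ⟨w, hw, h1⟩
  have hup : ∀ v, v ≠ q → ∃ w, (dualGrid n).Adj v w ∧ (-f) w = (-f) v - 1 := fun v hv => by
    by_cases hvp : v = p
    · subst hvp
      refine ⟨_, adj_vertNbr v, ?_⟩
      have h1 := hadj (adj_vertNbr v)
      have h2 := hp (vertNbr v)
      simp only [Pi.neg_apply]
      omega
    · obtain ⟨-, w, -, hw, -, h1⟩ := hmid v hvp hv
      refine ⟨w, hw, ?_⟩
      simp only [Pi.neg_apply]
      omega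
  have hlow : ∀ v, gridDist p v ≤ f v - f p := fun v =>
    gridDist_le_of_descent hp hdown _ (Int.self_le_toNat _)
  have hhigh : ∀ v, gridDist q v ≤ f q - f v := fun v => by
    have := gridDist_le_of_descent (f := -f) (p := q) (fun w => neg_le_neg (hq w)) hup _
      (Int.self_le_toNat ((-f) v - (-f) q))
    simp only [Pi.neg_apply] at this
    omega
  have hlip : ∀ v, f v - f p ≤ gridDist p v := fun v =>
    hf.isHeight.sub_le_gridDist _ (Int.self_le_toNat _)
  refine ⟨p, ?_, fun v => by
    have h1 := hlow v
    have h2 := hlip v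
    omega⟩
  have hcor : ∀ v, gridDist p v + gridDist q v ≤ gridDist p q := fun v => by
    have h1 := hlow v
    have h2 := hhigh v
    have h3 := hlip q
    omega
  have c0 := hcor (p.1, ⟨0, by omega⟩)
  have c1 := hcor (p.1, ⟨n - 1, by omega⟩)
  have hp2 := p.2.2
  have hq2 := q.2.2
  simp only [gridDist, sub_self, abs_zero, zero_add, abs_sub_comm (q.1.val : ℤ)] at c0 c1
  push_cast at c0
  rw [sub_zero, sub_zero, abs_of_nonneg (a := (p.2.val : ℤ)) (by omega),
    abs_of_nonneg (a := (q.2.val : ℤ)) (by omega)] at c0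
  rw [abs_of_nonpos (a := (p.2.val : ℤ) - ((n - 1 : ℕ) : ℤ)) (by omega),
    abs_of_nonpos (a := (q.2.val : ℤ) - ((n - 1 : ℕ) : ℤ)) (by omega)] at c1
  rcases abs_cases ((p.2.val : ℤ) - q.2.val) with h1 | h1 <;> omega

theorem sq_le_two_mul_sum_range (n : ℕ) : ∀ H : ℤ,
    (n : ℤ) ^ 2 ≤ 2 * ∑ j ∈ Finset.range n, (|(j : ℤ) - H| + |(j : ℤ) + 1 - H|) := by
  induction n using Nat.twoStepInduction with
  | zero => simp
  | one =>
    intro H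
    simp only [Finset.sum_range_one]
    simp only [Nat.cast_zero, Nat.cast_one, zero_add]
    rcases abs_cases (0 - H) with h1 | h1 <;> rcases abs_cases (1 - H) with h2 | h2 <;> omega
  | more n ih _ =>
    intro H
    rw [Finset.sum_range_succ, Finset.sum_range_succ']
    have h1 := ih (H - 1)
    have h2 : ∑ j ∈ Finset.range n, (|((j + 1 : ℕ) : ℤ) - H| + |((j + 1 : ℕ) : ℤ) + 1 - H|) =
        ∑ j ∈ Finset.range n, (|(j : ℤ) - (H - 1)| + |(j : ℤ) + 1 - (H - 1)|) :=
      Finset.sum_congr rfl fun j _ => by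
        push_cast
        congr 2 <;> ring
    rw [h2]
    push_cast
    have h3 := neg_abs_le (0 - H)
    have h4 := neg_abs_le (1 - H)
    have h5 := le_abs_self ((n : ℤ) + 1 - H)
    have h6 := le_abs_self ((n : ℤ) + 1 + 1 - H)
    nlinarith

theorem sq_le_two_mul_sum_gridDist {n : ℕ} {p : MiuraFace n}
    (hp : p.2.val = 0 ∨ p.2.val + 1 = n) (H : ℤ) :
    (n : ℤ) ^ 2 ≤ 2 * ∑ v, |gridDist p v - H| := by
  refine (sq_le_two_mul_sum_range n H).trans_eq ?_
  congr 1
  have hrow : ∀ c : ℤ, ∑ j : Fin n, |c + |(p.2.val : ℤ) - j.val| - H| =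
      ∑ j ∈ Finset.range n, |c + (j : ℤ) - H| := fun c => by
    rw [← Fin.sum_univ_eq_sum_range fun j => |c + (j : ℤ) - H|]
    rcases hp with hp | hp
    · rw [hp]
      simp
    · rw [← Equiv.sum_comp Fin.revPerm]
      refine Finset.sum_congr rfl fun j _ => ?_
      rw [Fin.revPerm_apply, Fin.val_rev, abs_of_nonneg (a := (p.2.val : ℤ) - _) (by omega)]
      congr 1
      omega
  rw [Finset.sum_add_distrib, Fintype.sum_prod_type, Fin.sum_univ_two]
  have h0 := hrow 0
  have h1 := hrow 1
  obtain ⟨i, j⟩ := p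
  simp only [gridDist] at h0 h1 ⊢
  fin_cases i
  · simp at h0 h1 ⊢
    rw [h0, h1]
    simp only [add_comm]
  · simp at h0 h1 ⊢
    rw [h0, h1, add_comm]
    simp only [add_comm]

/-! ## Distances in the origami flip graph -/

theorem isHeight_coord_sum (n : ℕ) :
    IsHeight (fun v : MiuraFace n => (v.1.val : ℤ) + v.2.val) := fun e => by
  cases e with
  | horiz j => simp [src, dst]
  | diag i k => fin_cases i <;> simp [src, dst]

theorem ofg_connected {n : ℕ} [NeZero n] {θ : ℝ} (hθ₀ : 0 < θ) (hθ₁ : θ < Real.pi / 2) :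
    (OFG n θ).Connected := by
  obtain ⟨μ, hμ⟩ := (isHeight_coord_sum n).exists_represents
  have : Nonempty (ValidMV n θ) := ⟨⟨μ, hμ.locallyValid hθ₀ hθ₁⟩⟩
  refine ⟨fun μ₁ μ₂ => ?_⟩
  obtain ⟨f, g, hf, hg, hp, -, -⟩ := exists_representing_pair hθ₀ hθ₁ μ₁ μ₂
  obtain ⟨p, -⟩ := exists_ofg_walk hθ₀ hθ₁ _ hf hg hp (Int.self_le_toNat _)
  exact ⟨p⟩

theorem two_mul_dist_le {n : ℕ} [NeZero n] {θ : ℝ} (hθ₀ : 0 < θ) (hθ₁ : θ < Real.pi / 2)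
    (μ₁ μ₂ : ValidMV n θ) : 2 * ((OFG n θ).dist μ₁ μ₂ : ℤ) ≤ (n : ℤ) ^ 2 + 1 := by
  obtain ⟨f, g, hf, hg, hp, hle, -⟩ := exists_representing_pair hθ₀ hθ₁ μ₁ μ₂
  obtain ⟨p, hlen⟩ := exists_ofg_walk hθ₀ hθ₁ _ hf hg hp (Int.self_le_toNat _)
  have := SimpleGraph.dist_le p
  omega

theorem sq_le_two_mul_dist {n : ℕ} [NeZero n] {θ : ℝ} (hθ₀ : 0 < θ) (hθ₁ : θ < Real.pi / 2)
    {ν ν' : ValidMV n θ} (h : ofgDegree ν = 2) (hopp : ∀ e, ν'.val e = -ν.val e) :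
    (n : ℤ) ^ 2 ≤ 2 * ((OFG n θ).dist ν ν' : ℤ) := by
  obtain ⟨p, hlen⟩ := (ofg_connected hθ₀ hθ₁).exists_walk_length_eq_dist ν ν'
  obtain ⟨f, hf⟩ := exists_represents hθ₀ hθ₁ ν.2
  obtain ⟨g, hg, hpar, hsum⟩ := exists_height_of_ofg_walk hθ₀ hθ₁ p hf
  obtain ⟨c, hc, hcd⟩ := exists_eq_gridDist_of_degree_two hθ₀ hθ₁ hf h
  have hconst : ∀ v, f v + g v = f c + g c := fun v =>
    eq_of_forall_crease (fun v => f v + g v) (fun e => by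
      have h1 := hf e
      have h2 := hg e
      rw [hopp, Units.val_neg] at h2
      omega) v c
  obtain ⟨H, hH⟩ := hpar c
  have hd : ∀ v, g v - f v = -(2 * (gridDist c v - H)) := fun v => by
    have h1 := hconst v
    have h2 := hcd v
    omega
  simp only [hd, abs_neg, abs_mul, abs_two, ← Finset.mul_sum] at hsum
  have := sq_le_two_mul_sum_gridDist hc H
  omega

theorem flippableFaces_eq_of_neg {n : ℕ} {θ : ℝ} (hθ₀ : 0 < θ) (hθ₁ : θ < Real.pi / 2)
    {f : MiuraFace n → ℤ} {μ ν : ValidMV n θ} (hf : Represents f μ.val)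
    (hg : Represents (-f) ν.val) : flippableFaces μ = flippableFaces ν := by
  ext α
  rw [mem_flippableFaces_iff hθ₀ hθ₁ hf, mem_flippableFaces_iff hθ₀ hθ₁ hg]
  simp only [Pi.neg_apply, neg_inj]

theorem flippableFaces_coord_sum {n : ℕ} {θ : ℝ} (hθ₀ : 0 < θ) (hθ₁ : θ < Real.pi / 2)
    (hn : 2 ≤ n) {μ : ValidMV n θ}
    (hf : Represents (fun v : MiuraFace n => (v.1.val : ℤ) + v.2.val) μ.val) :
    flippableFaces μ = {(0, ⟨0, by omega⟩), (1, ⟨n - 1, by omega⟩)} := by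
  ext ⟨i, j, hj⟩
  rw [mem_flippableFaces_iff hθ₀ hθ₁ hf]
  simp only [Set.mem_insert_iff, Set.mem_singleton_iff, Prod.mk.injEq, Fin.mk.injEq, vertNbr]
  constructor
  · intro h
    fin_cases i
    · left
      refine ⟨rfl, ?_⟩
      by_contra h0
      have := h (0, ⟨j - 1, by omega⟩)
        (dualGrid_adj_iff.2 (Or.inr ⟨rfl, Or.inr (by dsimp only; omega)⟩))
      simp at this
      omega
    · right
      refine ⟨rfl, ?_⟩
      by_contra h0
      have := h (1, ⟨j + 1, by omega⟩) (dualGrid_adj_iff.2 (Or.inr ⟨rfl, Or.inl rfl⟩))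
      simp at this
      omega
  · rintro h ⟨i', j', hj'⟩ hw
    rw [dualGrid_adj_iff] at hw
    rcases h with ⟨rfl, rfl⟩ | ⟨rfl, rfl⟩ <;> fin_cases i' <;> simp at hw ⊢ <;> omega

theorem exists_opposite_degree_two {n : ℕ} {θ : ℝ} (hθ₀ : 0 < θ) (hθ₁ : θ < Real.pi / 2)
    (hn : 2 ≤ n) : ∃ ν ν' : ValidMV n θ, ofgDegree ν = 2 ∧ ofgDegree ν' = 2 ∧ OppositeMV ν ν' := by
  have hf := isHeight_coord_sum n
  obtain ⟨μ, hμ⟩ := hf.exists_represents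
  obtain ⟨ν, hν⟩ := (isHeight_neg hf).exists_represents
  have heq := flippableFaces_eq_of_neg hθ₀ hθ₁ (μ := ⟨μ, hμ.locallyValid hθ₀ hθ₁⟩)
    (ν := ⟨ν, hν.locallyValid hθ₀ hθ₁⟩) hμ hν
  have hdeg : ofgDegree (⟨μ, hμ.locallyValid hθ₀ hθ₁⟩ : ValidMV n θ) = 2 := by
    rw [ofgDegree_eq hn, flippableFaces_coord_sum hθ₀ hθ₁ hn hμ]
    exact Set.ncard_pair (by simp)
  refine ⟨_, _, hdeg, ?_, heq, fun e => Units.ext ?_⟩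
  · rw [ofgDegree_eq hn] at hdeg ⊢
    rwa [← heq]
  · rw [Units.val_neg, ← hμ e, ← hν e]
    simp only [Pi.neg_apply]
    ring

theorem mainTheorem3 (n : ℕ) [NeZero n] (θ : ℝ) (hθ₀ : 0 < θ) (hθ₁ : θ < Real.pi / 2) :
    -- corresponding 3-colorings whose minimized height sum is at most `⌈n² / 2⌉`
    (∀ μ₁ μ₂ : ValidMV n θ,
      ∃ (γ β : GridColoring n) (R : (reconfGraph n).Walk γ β),
        Corresponds μ₁.val γ ∧ Corresponds μ₂.val β ∧
        (∀ H' : ℤ, heightSum γ β (absHeight (topLeft n) R) ≤ heightSum γ β H') ∧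
        (1 / 2 : ℚ) * (heightSum γ β (absHeight (topLeft n) R) : ℚ) ≤ (⌈(n : ℚ) ^ 2 / 2⌉ : ℤ)) ∧
    -- no pair of vertices is farther apart than two opposite vertices of degree 2
    (OFG n θ).Connected ∧
    (∀ ν ν' : ValidMV n θ, ofgDegree ν = 2 → ofgDegree ν' = 2 → OppositeMV ν ν' →
      ∀ μ₁ μ₂ : ValidMV n θ, (OFG n θ).dist μ₁ μ₂ ≤ (OFG n θ).dist ν ν') ∧
    (2 ≤ n → ∃ ν ν' : ValidMV n θ, ofgDegree ν = 2 ∧ ofgDegree ν' = 2 ∧ OppositeMV ν ν') := by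
  refine ⟨fun μ₁ μ₂ => ?_, ofg_connected hθ₀ hθ₁, fun ν ν' h _ hopp μ₁ μ₂ => ?_,
    exists_opposite_degree_two hθ₀ hθ₁⟩
  · obtain ⟨f, g, hf, hg, hp, hle, hmin⟩ := exists_representing_pair hθ₀ hθ₁ μ₁ μ₂
    obtain ⟨R, hR⟩ := exists_recoloring _ (topLeft n) hf.isHeight hg.isHeight hp
      (Int.self_le_toNat _)
    have hsum : ∀ H : ℤ, heightSum hf.isHeight.coloring hg.isHeight.coloring H =
        ∑ v, |(H - (g (topLeft n) - f (topLeft n))) + (g v - f v)| := fun H => by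
      refine Finset.sum_congr rfl fun v _ => ?_
      rw [IsHeight.relHeight_coloring]
      congr 1
      ring
    have hH : heightSum hf.isHeight.coloring hg.isHeight.coloring (absHeight (topLeft n) R) =
        ∑ v, |g v - f v| := by
      rw [hsum, hR]
      simp only [sub_self, zero_add]
    refine ⟨_, _, R, hf.corresponds, hg.corresponds, fun H' => ?_, ?_⟩
    · rw [hH, hsum]
      exact hmin _
    · rw [hH]
      have heven : Even (∑ v, |g v - f v|) := Finset.even_sum _ fun v _ => even_abs.2 (hp v)
      obtain ⟨s, hs⟩ := heven
      have h1 : (n : ℚ) ^ 2 / 2 ≤ ⌈(n : ℚ) ^ 2 / 2⌉ := Int.le_ceil _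
      have h2 : (n : ℤ) ^ 2 ≤ 2 * ⌈(n : ℚ) ^ 2 / 2⌉ := by
        have : (n : ℚ) ^ 2 ≤ 2 * ⌈(n : ℚ) ^ 2 / 2⌉ := by linarith
        exact_mod_cast this
      have h3 : s ≤ ⌈(n : ℚ) ^ 2 / 2⌉ := by omega
      have h4 : (1 / 2 : ℚ) * ((s + s : ℤ) : ℚ) = (s : ℚ) := by
        push_cast
        ring
      rw [hs, h4]
      exact_mod_cast h3
  · have h1 := two_mul_dist_le hθ₀ hθ₁ μ₁ μ₂
    have h2 := sq_le_two_mul_dist hθ₀ hθ₁ h hopp.2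
    omega
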